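/- Let $\mathcal H,\mathcal K$ be complex Hilbert spaces, let $0<m\le M$ be real numbers, and let $A$ be a bounded operator on $\mathcal H$ with $mI\le A\le MI$. Let $X,Y$ be isometries on $\mathcal H$ whose final spaces (ranges) are orthogonal to each other. Let $\Phi:\mathcal B(\mathcal H)\to\mathcal B(\mathcal K)$ be a unital ($\Phi(I)=I$) $2$-positive linear map, i.e. for all $S,T,U\in\mathcal B(\mathcal H)$, $$\begin{bmatrix} S&T\\ T^*&U\end{bmatrix}\ge 0\quad\text{implies}\quad \begin{bmatrix} \Phi(S)&\Phi(T)\\ \Phi(T^*)&\Phi(U)\end{bmatrix}\ge 0 .$$ Then $\Phi(Y^*AY)$ and $\Phi(X^*AX)$ are positive and invertible, the operator $Z:=\Phi(X^*AY)\,\Phi(Y^*AY)^{-1}\,\Phi(Y^*AX)$ is positive, and, in the operator norm, $$\left\|Z^{p/2}\,\Phi(X^*AX)^{-p/2}\right\|\le \frac{(M-m)^p\,(M+m)^{p/2}}{2^{2+p/2}\,M^{3p/4}m^{3p/4}}\qquad\text{for all real } p\ge 2,$$ $$\left\|Z^{p/2}\,\Phi(X^*AX)^{-p/2}\right\|\le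 \frac{(M-m)^p\,(M^2+m^2)^{p/2}}{2^{2+p/2}\,M^{3p/4}m^{3p/4}\,(M+m)^{p/2}}\qquad\text{for all real } p\ge 4.$$ -/

import Mathlib

open scoped InnerProductSpace

namespace WielandtNorm

noncomputable section

/-- The operator matrix `[A B; C D]` acting on the Hilbert space direct sum `H ⊕ H`,
`(x, y) ↦ (A x + B y, C x + D y)`. -/
def opMatrix {H : Type*} [NormedAddCommGroup H] [InnerProductSpace ℂ H]
    (A B C D : H →L[ℂ] H) : WithLp 2 (H × H) →L[ℂ] WithLp 2 (H × H) :=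
  (WithLp.prodContinuousLinearEquiv 2 ℂ H H).symm.toContinuousLinearMap ∘L
    ((A.coprod B).prod (C.coprod D)) ∘L
      (WithLp.prodContinuousLinearEquiv 2 ℂ H H).toContinuousLinearMap

/-- A linear map `Φ : B(H) → B(K)` is 2-positive if `[A B; B* C] ≥ 0` implies
`[Φ(A) Φ(B); Φ(B*) Φ(C)] ≥ 0`. -/
def IsTwoPositive {H K : Type*}
    [NormedAddCommGroup H] [InnerProductSpace ℂ H] [CompleteSpace H]
    [NormedAddCommGroup K] [InnerProductSpace ℂ K]
    (Φ : (H →L[ℂ] H) →ₗ[ℂ] (K →L[ℂ] K)) : Prop :=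
  ∀ A B C : H →L[ℂ] H, 0 ≤ opMatrix A B (star B) C →
    0 ≤ opMatrix (Φ A) (Φ B) (Φ (star B)) (Φ C)

/-- The operator `Φ(X*AY) Φ(Y*AY)⁻¹ Φ(Y*AX)`. (`Ring.inverse` is the inverse of an invertible
operator.) -/
def wielandtOp {H K : Type*}
    [NormedAddCommGroup H] [InnerProductSpace ℂ H] [CompleteSpace H]
    [NormedAddCommGroup K] [InnerProductSpace ℂ K]
    (Φ : (H →L[ℂ] H) →ₗ[ℂ] (K →L[ℂ] K)) (A X Y : H →L[ℂ] H) : K →L[ℂ] K :=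
  Φ (star X * A * Y) * Ring.inverse (Φ (star Y * A * Y)) * Φ (star Y * A * X)

end

end WielandtNorm

/-!
Write `Z` for the Wielandt operator, `T = Φ(X*AX)` and `k = (M - m) / (M + m)`. Since `X*Y = 0`,
replacing `X` by `X - c A⁻¹ X` does not change `X*AY`, and for a suitable scalar `c` Kantorovich's
inequality `A + M m A⁻¹ ≤ M + m` bounds the compression of `A` to the new columns by `k² X*AX`.
Hence `[k² X*AX, X*AY; Y*AX, Y*AY] ≥ 0`; applying `Φ` and taking the Schur complement gives
`Z ≤ k² T`.

For the norms, `α P + β W⁻¹ ≤ 1` for suitable scalars as soon as `P ≤ κ W`, again by Kantorovich's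
inequality for `W`. As `x ^ r ≤ x` on `[0, 1]` for `r ≥ 1`, the `r`-th powers `a` and `b` of the two
summands still satisfy `a + b ≤ 1`, so `[a - a², -ab; -ba, b - b²] ≥ 0`; the diagonal entries being
at most `1 / 4`, this forces `‖ab‖ ≤ 1 / 4`. The pair `(Z, T)` with `r = p / 2` gives the first
bound, and `(Z², T²)` with `r = p / 4` the second, where `Z ≤ k² T` yields a bound of `Z²` by `T²`
through Kantorovich's inequality for `T`.
-/

open scoped Ring

namespace WielandtNorm

theorem rpow_mul_rpow_div_eq {d x m M : ℝ} (hd : 0 ≤ d) (hx : 0 ≤ x) (hm : 0 < m) (hM : 0 < M)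
    (p : ℝ) :
    d ^ p * x ^ (p / 2) / (2 ^ (2 + p / 2) * M ^ (3 * p / 4) * m ^ (3 * p / 4)) =
      (d ^ 4 * x ^ 2 / (4 * (M * m) ^ 3)) ^ (p / 4) / 4 := by
  have hpow (y : ℝ) (hy : 0 ≤ y) (n : ℕ) : (y ^ n) ^ (p / 4) = y ^ (n * p / 4) := by
    rw [← Real.rpow_natCast_mul hy, mul_div_assoc]
  have h2 : (2 : ℝ) ^ (2 + p / 2) = 4 ^ (p / 4) * 4 := by
    rw [Real.rpow_add two_pos, show (4 : ℝ) ^ (p / 4) = ((2 : ℝ) ^ 2) ^ (p / 4) by norm_num,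
      hpow 2 two_pos.le, mul_comm]
    norm_num
    ring_nf
  rw [Real.div_rpow (by positivity) (by positivity), Real.mul_rpow (by positivity) (by positivity),
    Real.mul_rpow (by positivity) (by positivity), mul_pow,
    Real.mul_rpow (by positivity) (by positivity), hpow d hd, hpow x hx, hpow M hM.le,
    hpow m hm.le, h2]
  push_cast
  rw [mul_div_cancel_left₀ p (by norm_num), show 2 * p / 4 = p / 2 by ring, div_div]
  ring

section CStarAlgebra

variable {𝓐 : Type*} [CStarAlgebra 𝓐] [PartialOrder 𝓐] [StarOrderedRing 𝓐]

theorem star_mul_self_le_add_of_add_le_one {a b : 𝓐} (ha : 0 ≤ a) (hb : 0 ≤ b)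
    (hab : a + b ≤ 1) (u v : 𝓐) :
    star (a * u + b * v) * (a * u + b * v) ≤ star u * a * u + star v * b * v := by
  set w := a * u + b * v with hw
  have hw' : star w = star u * a + star v * b := by
    simp only [hw, star_add, star_mul, ha.star_eq, hb.star_eq]
  have huw : 0 ≤ star (u - w) * a * (u - w) := star_left_conjugate_nonneg ha _
  have hvw : 0 ≤ star (v - w) * b * (v - w) := star_left_conjugate_nonneg hb _
  have hww : star w * (a + b) * w ≤ star w * w := by
    simpa using star_left_conjugate_le_conjugate hab w
  have key : star u * a * u + star v * b * v - star w * w =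
      star (u - w) * a * (u - w) + star (v - w) * b * (v - w) +
        (star w * w - star w * (a + b) * w) := by
    have h1 : star w * w = (star u * a + star v * b) * w := by rw [hw']
    have h2 : star w * w = star w * (a * u + b * v) := by rw [hw]
    linear_combination (norm := (simp only [star_sub]; noncomm_ring)) -h1 - h2
  rw [← sub_nonneg, key]
  exact add_nonneg (add_nonneg huw hvw) (sub_nonneg.2 hww)

theorem smul_le_sq_add {a : 𝓐} (ha : IsSelfAdjoint a) (t : ℝ) :
    t • a ≤ a ^ 2 + (t ^ 2 / 4) • 1 := by
  have hsq : 0 ≤ (a - (t / 2) • 1) * (a - (t / 2) • 1) :=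
    (ha.sub (.smul (.all _) (.one 𝓐))).mul_self_nonneg
  rw [← sub_nonneg]
  convert hsq using 1
  simp only [sub_mul, mul_sub, pow_two, smul_mul_assoc, mul_smul_comm, one_mul, mul_one]
  module

theorem norm_mul_le_quarter {a b : 𝓐} (ha : 0 ≤ a) (hb : 0 ≤ b) (hab : a + b ≤ 1) :
    ‖a * b‖ ≤ 1 / 4 := by
  -- Among `w = t (ab)`, the choice `t = 4` is the one that gets the most out of the resulting
  -- inequality `2t (ab)*(ab) ≤ (t² (ab)*(ab) + 1) / 4`.
  set w := (4 : ℝ) • (a * b) with hw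
  have hwab : star w * a * b = (1 / 4 : ℝ) • (star w * w) := by
    rw [hw, mul_smul_comm, smul_smul, ← mul_assoc]
    norm_num
  have hbaw : b * a * w = (1 / 4 : ℝ) • (star w * w) := by
    have hw' : star w = (4 : ℝ) • (b * a) := by
      rw [hw, star_smul, star_mul, ha.star_eq, hb.star_eq, star_trivial]
    rw [hw', smul_mul_assoc, smul_smul]
    norm_num
  have hsum : star (a * w + b * 1) * (a * w + b * 1) ≤ star w * a * w + star 1 * b * 1 :=
    star_mul_self_le_add_of_add_le_one ha hb hab w 1
  have ha' := star_left_conjugate_le_conjugate (smul_le_sq_add ha.isSelfAdjoint 1) w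
  have hb' := smul_le_sq_add hb.isSelfAdjoint 1
  have hww : star w * w ≤ 1 := by
    rw [← sub_nonneg] at hsum ha' hb' ⊢
    convert smul_nonneg (zero_le_four (α := ℝ)) (add_nonneg (add_nonneg hsum ha') hb') using 1
    simp only [star_add, star_mul, star_one, ha.star_eq, hb.star_eq, mul_add, add_mul, pow_two,
      mul_one, one_mul, mul_smul_comm, smul_mul_assoc, ← mul_assoc, hwab, hbaw]
    module
  have hnorm : ‖w‖ * ‖w‖ ≤ 1 := by
    rw [← CStarRing.norm_star_mul_self]
    exact (CStarAlgebra.norm_le_one_iff_of_nonneg _ (star_mul_self_nonneg w)).2 hww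
  rw [hw, norm_smul, Real.norm_ofNat] at hnorm
  nlinarith [norm_nonneg (a * b)]

theorem rpow_le_self {a : 𝓐} (ha : 0 ≤ a) (ha₁ : a ≤ 1) {r : ℝ} (hr : 1 ≤ r) : a ^ r ≤ a := by
  have hspec : ∀ x ∈ spectrum ℝ a, x ≤ 1 :=
    (le_algebraMap_iff_spectrum_le (r := (1 : ℝ))).1 (by simpa using ha₁)
  have hcont : ContinuousOn (fun x : ℝ => x ^ r) (spectrum ℝ a) :=
    (Real.continuous_rpow_const (by positivity)).continuousOn
  conv_rhs => rw [← cfc_id' ℝ a]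
  rw [CFC.rpow_eq_cfc_real, cfc_le_iff _ _ a hcont]
  exact fun x hx => Real.rpow_le_self_of_le_one (spectrum_nonneg_of_nonneg ha hx) (hspec x hx) hr

theorem smul_rpow {a : 𝓐} (ha : 0 ≤ a) {t : ℝ} (ht : 0 ≤ t) {r : ℝ} (hr : 0 ≤ r) :
    (t • a) ^ r = t ^ r • a ^ r := by
  have hcont {s : Set ℝ} : ContinuousOn (fun x : ℝ => x ^ r) s :=
    (Real.continuous_rpow_const hr).continuousOn
  rw [CFC.rpow_eq_cfc_real (smul_nonneg ht ha), CFC.rpow_eq_cfc_real ha,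
    ← cfc_comp_const_mul t _ a hcont, ← cfc_const_mul _ _ a hcont]
  exact cfc_congr fun x hx => Real.mul_rpow ht (spectrum_nonneg_of_nonneg ha hx)

theorem norm_rpow_mul_rpow_le {a b : 𝓐} (ha : 0 ≤ a) (hb : 0 ≤ b) {α β : ℝ} (hα : 0 < α)
    (hβ : 0 < β) (hab : α • a + β • b ≤ 1) {r : ℝ} (hr : 1 ≤ r) :
    ‖a ^ r * b ^ r‖ ≤ ((α * β) ^ r)⁻¹ / 4 := by
  have hr₀ : 0 ≤ r := by positivity
  have ha' : 0 ≤ α • a := smul_nonneg hα.le ha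
  have hb' : 0 ≤ β • b := smul_nonneg hβ.le hb
  have ha₁ : α • a ≤ 1 := (le_add_of_nonneg_right hb').trans hab
  have hb₁ : β • b ≤ 1 := (le_add_of_nonneg_left ha').trans hab
  have hsum : (α • a) ^ r + (β • b) ^ r ≤ 1 :=
    (add_le_add (rpow_le_self ha' ha₁ hr) (rpow_le_self hb' hb₁ hr)).trans hab
  have hnorm : ‖(α • a) ^ r * (β • b) ^ r‖ ≤ 1 / 4 :=
    norm_mul_le_quarter CFC.rpow_nonneg CFC.rpow_nonneg hsum
  rw [smul_rpow ha hα.le hr₀, smul_rpow hb hβ.le hr₀, smul_mul_smul_comm,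
    ← Real.mul_rpow hα.le hβ.le, norm_smul, Real.norm_of_nonneg (by positivity)] at hnorm
  rw [inv_eq_one_div, div_right_comm, le_div_iff₀' (by positivity)]
  exact hnorm

theorem sq_le_sq_of_commute {a b : 𝓐} (ha : 0 ≤ a) (hab : a ≤ b) (hcomm : Commute a b) :
    a ^ 2 ≤ b ^ 2 := by
  rw [← sub_nonneg, hcomm.symm.sq_sub_sq]
  have hcomm' : Commute (b + a) (b - a) :=
    .add_left (.sub_right (.refl b) hcomm.symm) (.sub_right hcomm (.refl a))
  exact hcomm'.mul_nonneg (add_nonneg (ha.trans hab) ha) (sub_nonneg.2 hab)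

theorem sq_add_smul_one_le {a : 𝓐} {m M : ℝ} (hm : m • 1 ≤ a) (hM : a ≤ M • 1) :
    a ^ 2 + (M * m) • 1 ≤ (M + m) • a := by
  have hcomm : Commute (a - m • 1) (M • 1 - a) := by
    simp only [commute_iff_eq, sub_mul, mul_sub, smul_mul_assoc, mul_smul_comm, one_mul, mul_one]
    module
  have hprod : 0 ≤ (a - m • 1) * (M • 1 - a) :=
    hcomm.mul_nonneg (sub_nonneg.2 hm) (sub_nonneg.2 hM)
  rw [← sub_nonneg]
  convert hprod using 1
  simp only [sub_mul, mul_sub, pow_two, smul_mul_assoc, mul_smul_comm, one_mul, mul_one]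
  module

theorem isStrictlyPositive_of_smul_one_le {a : 𝓐} {m : ℝ} (hm : 0 < m) (ha : m • 1 ≤ a) :
    IsStrictlyPositive a :=
  .of_le (.smul hm isStrictlyPositive_one) ha

theorem add_smul_inverse_le {a : 𝓐} {m M : ℝ} (hm₀ : 0 < m) (hm : m • 1 ≤ a)
    (hM : a ≤ M • 1) : a + (M * m) • a⁻¹ʳ ≤ (M + m) • 1 := by
  have ha : IsStrictlyPositive a := isStrictlyPositive_of_smul_one_le hm₀ hm
  have hinv : a * a⁻¹ʳ = 1 := Ring.mul_inverse_cancel a ha.isUnit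
  have hinv' : a⁻¹ʳ * a = 1 := Ring.inverse_mul_cancel a ha.isUnit
  have hcomm : Commute a⁻¹ʳ ((M + m) • a - (a ^ 2 + (M * m) • 1)) := by
    refine .sub_right (.smul_right ?_ _) (.add_right (.pow_right ?_ _) (.smul_right ?_ _))
    exacts [hinv'.trans hinv.symm, hinv'.trans hinv.symm, .one_right _]
  have hprod : 0 ≤ a⁻¹ʳ * ((M + m) • a - (a ^ 2 + (M * m) • 1)) :=
    hcomm.mul_nonneg ha.ringInverse.nonneg (sub_nonneg.2 (sq_add_smul_one_le hm hM))
  rw [← sub_nonneg]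
  convert hprod using 1
  simp only [mul_sub, mul_add, mul_smul_comm, pow_two, ← mul_assoc, hinv', one_mul, mul_one]

theorem mul_inverse_mul_le {a b : 𝓐} (ha : IsStrictlyPositive a) (hb : 0 ≤ b) {c : ℝ}
    (hc : 0 ≤ c) (hab : b ≤ c • a) : b * a⁻¹ʳ * b ≤ c • b := by
  obtain rfl | hc := hc.eq_or_lt
  · obtain rfl : b = 0 := le_antisymm (by simpa using hab) hb
    simp
  have hs : star a⁻¹ʳ = a⁻¹ʳ := ha.ringInverse.nonneg.star_eq
  have hinv : a⁻¹ʳ * a = 1 := Ring.inverse_mul_cancel a ha.isUnit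
  have hsq : 0 ≤ star (c • 1 - a⁻¹ʳ * b) * b * (c • 1 - a⁻¹ʳ * b) :=
    star_left_conjugate_nonneg hb _
  have hcube : star (a⁻¹ʳ * b) * b * (a⁻¹ʳ * b) ≤ star (a⁻¹ʳ * b) * (c • a) * (a⁻¹ʳ * b) :=
    star_left_conjugate_le_conjugate hab _
  have key : c • (c • b - b * a⁻¹ʳ * b) =
      star (c • 1 - a⁻¹ʳ * b) * b * (c • 1 - a⁻¹ʳ * b) +
        (star (a⁻¹ʳ * b) * (c • a) * (a⁻¹ʳ * b) - star (a⁻¹ʳ * b) * b * (a⁻¹ʳ * b)) := by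
    have h : b * a⁻¹ʳ * a = b := by rw [mul_assoc, hinv, mul_one]
    simp only [star_sub, star_smul, star_mul, star_one, hs, hb.star_eq, sub_mul, mul_sub,
      smul_mul_assoc, mul_smul_comm, one_mul, mul_one, ← mul_assoc, h, star_trivial]
    module
  have hpos : 0 ≤ c • (c • b - b * a⁻¹ʳ * b) := key ▸ add_nonneg hsq (sub_nonneg.2 hcube)
  simpa [hc.ne'] using smul_nonneg (inv_nonneg.2 hc.le) hpos

theorem conj_one_sub_smul_inverse_le {a : 𝓐} {m M : ℝ} (hm₀ : 0 < m) (hM₀ : 0 < M)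
    (hm : m • 1 ≤ a) (hM : a ≤ M • 1) :
    star (1 - (2 * (M * m) / (M + m)) • a⁻¹ʳ) * a * (1 - (2 * (M * m) / (M + m)) • a⁻¹ʳ) ≤
      ((M - m) / (M + m)) ^ 2 • a := by
  have ha : IsStrictlyPositive a := isStrictlyPositive_of_smul_one_le hm₀ hm
  have hs : star a⁻¹ʳ = a⁻¹ʳ := ha.ringInverse.nonneg.star_eq
  have hinv : a * a⁻¹ʳ = 1 := Ring.mul_inverse_cancel a ha.isUnit
  have hinv' : a⁻¹ʳ * a = 1 := Ring.inverse_mul_cancel a ha.isUnit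
  have hkant := smul_le_smul_of_nonneg_left (add_smul_inverse_le hm₀ hm hM)
    (show 0 ≤ 4 * (M * m) / (M + m) ^ 2 by positivity)
  rw [← sub_nonneg] at hkant ⊢
  convert hkant using 1
  simp only [star_sub, star_one, star_smul, star_trivial, hs, sub_mul, mul_sub, smul_mul_assoc,
    mul_smul_comm, one_mul, mul_one, hinv, hinv']
  match_scalars <;> field_simp <;> ring

theorem mul_star_self_le_of_star_mul_self_le {a : 𝓐} {c : ℝ} (hc : 0 ≤ c)
    (h : star a * a ≤ c • 1) : a * star a ≤ c • 1 := by
  rw [← Algebra.algebraMap_eq_smul_one] at h ⊢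
  rw [← CStarAlgebra.norm_le_iff_le_algebraMap _ hc (mul_star_self_nonneg a),
    CStarRing.norm_self_mul_star, ← CStarRing.norm_star_mul_self]
  exact (CStarAlgebra.norm_le_iff_le_algebraMap _ hc).2 h

theorem sq_le_smul_sq {a b : 𝓐} {m M : ℝ} (hm₀ : 0 < m) (hM₀ : 0 < M)
    (hm : m • 1 ≤ a) (hM : a ≤ M • 1) (hb : 0 ≤ b) {c : ℝ} (hc : 0 ≤ c) (hab : b ≤ c • a) :
    b ^ 2 ≤ (((M + m) * c) ^ 2 / (4 * (M * m))) • a ^ 2 := by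
  have ha : IsStrictlyPositive a := isStrictlyPositive_of_smul_one_le hm₀ hm
  set q := a⁻¹ʳ * b with hq
  have haq : a * q = b := by
    rw [hq, ← mul_assoc, Ring.mul_inverse_cancel a ha.isUnit, one_mul]
  have hqa : star q * a = b := by rw [← ha.nonneg.star_eq, ← star_mul, haq, hb.star_eq]
  have hconj : b ^ 2 + (M * m) • (star q * q) ≤ (M + m) • (b * a⁻¹ʳ * b) := by
    convert star_left_conjugate_le_conjugate (sq_add_smul_one_le hm hM) q using 1
    · simp only [pow_two, mul_add, add_mul, mul_smul_comm, smul_mul_assoc, mul_one,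
        ← mul_assoc, hqa]
      rw [mul_assoc b, haq]
    · rw [mul_smul_comm, smul_mul_assoc, hqa, hq, mul_assoc]
  have hlin : (M + m) • (b * a⁻¹ʳ * b) ≤ ((M + m) * c) • b := by
    rw [mul_smul]
    exact smul_le_smul_of_nonneg_left (mul_inverse_mul_le ha hb hc hab) (by positivity)
  have hqq : (M * m) • (star q * q) ≤ (((M + m) * c) ^ 2 / 4) • 1 :=
    le_of_add_le_add_left <| hconj.trans <| hlin.trans <| smul_le_sq_add hb.isSelfAdjoint _
  have hqq' : star q * q ≤ (((M + m) * c) ^ 2 / (4 * (M * m))) • 1 := by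
    rw [← smul_le_smul_iff_of_pos_left (show 0 < M * m by positivity), smul_smul]
    convert hqq using 2
    field_simp
  convert star_left_conjugate_le_conjugate
    (mul_star_self_le_of_star_mul_self_le (by positivity) hqq') a using 1
  · rw [ha.nonneg.star_eq, ← mul_assoc, haq, mul_assoc, hqa, pow_two]
  · rw [ha.nonneg.star_eq, mul_smul_comm, smul_mul_assoc, mul_one, pow_two a]

theorem norm_rpow_mul_rpow_neg_le {a b : 𝓐} {n N : ℝ} (hn₀ : 0 < n) (hN₀ : 0 < N)
    (hn : n • 1 ≤ b) (hN : b ≤ N • 1) (ha : 0 ≤ a) {c : ℝ} (hc : 0 ≤ c) (hab : a ≤ c • b)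
    {r : ℝ} (hr : 1 ≤ r) :
    ‖a ^ r * b ^ (-r)‖ ≤ (c * (N + n) ^ 2 / (N * n)) ^ r / 4 := by
  have hr₀ : r ≠ 0 := by positivity
  have hb : IsStrictlyPositive b := isStrictlyPositive_of_smul_one_le hn₀ hn
  obtain rfl | hc := hc.eq_or_lt
  · obtain rfl : a = 0 := le_antisymm (by simpa using hab) ha
    rw [← CFC.rpow_eq_pow (a := (0 : 𝓐)), CFC.zero_rpow hr₀, zero_mul, norm_zero]
    positivity
  have hbr : b⁻¹ʳ ^ r = b ^ (-r) := by
    rw [CFC.inverse_eq_rpow_neg_one hb, CFC.rpow_rpow _ _ _ (by norm_num), neg_one_mul]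
  have hsum : (1 / (c * (N + n))) • a + (N * n / (N + n)) • b⁻¹ʳ ≤ 1 := by
    have h : (N + n)⁻¹ • (c⁻¹ • a + (N * n) • b⁻¹ʳ) ≤ (N + n)⁻¹ • ((N + n) • (1 : 𝓐)) := by
      refine smul_le_smul_of_nonneg_left ?_ (by positivity)
      refine le_trans ?_ (add_smul_inverse_le hn₀ hn hN)
      gcongr
      rwa [inv_smul_le_iff_of_pos hc]
    rw [inv_smul_smul₀ (by positivity)] at h
    convert h using 1
    rw [smul_add, smul_smul, smul_smul]
    congr 2
    all_goals field_simp
  have h := norm_rpow_mul_rpow_le ha hb.ringInverse.nonneg (by positivity) (by positivity) hsum hr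
  rw [hbr] at h
  convert h using 2
  rw [← Real.inv_rpow (by positivity)]
  congr 1
  field_simp

theorem norm_rpow_mul_rpow_neg_le_of_two_le {a b : 𝓐} {m M : ℝ} (hm₀ : 0 < m) (hmM : m ≤ M)
    (hm : m • 1 ≤ b) (hM : b ≤ M • 1) (ha : 0 ≤ a) (hab : a ≤ ((M - m) / (M + m)) ^ 2 • b)
    {p : ℝ} (hp : 2 ≤ p) :
    ‖a ^ (p / 2) * b ^ (-(p / 2))‖ ≤ (M - m) ^ p * (M + m) ^ (p / 2) /
      (2 ^ (2 + p / 2) * M ^ (3 * p / 4) * m ^ (3 * p / 4)) := by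
  have hM₀ : 0 < M := hm₀.trans_le hmM
  have hd : 0 ≤ M - m := sub_nonneg.2 hmM
  have hbase : (((M - m) / (M + m)) ^ 2 * (M + m) ^ 2 / (M * m)) ^ 2 ≤
      (M - m) ^ 4 * (M + m) ^ 2 / (4 * (M * m) ^ 3) := by
    have hamgm : 4 * (M * m) ≤ (M + m) ^ 2 := by nlinarith [sq_nonneg (M - m)]
    rw [← mul_pow, div_mul_cancel₀ _ (by positivity), div_pow, ← pow_mul,
      div_le_div_iff₀ (by positivity) (by positivity)]
    calc (M - m) ^ 4 * (4 * (M * m) ^ 3) = (M - m) ^ 4 * (M * m) ^ 2 * (4 * (M * m)) := by ring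
      _ ≤ (M - m) ^ 4 * (M * m) ^ 2 * (M + m) ^ 2 := by gcongr
      _ = (M - m) ^ 4 * (M + m) ^ 2 * (M * m) ^ 2 := by ring
  calc ‖a ^ (p / 2) * b ^ (-(p / 2))‖
      ≤ (((M - m) / (M + m)) ^ 2 * (M + m) ^ 2 / (M * m)) ^ (p / 2) / 4 :=
        norm_rpow_mul_rpow_neg_le hm₀ hM₀ hm hM ha (sq_nonneg _) hab (by linarith)
    _ = ((((M - m) / (M + m)) ^ 2 * (M + m) ^ 2 / (M * m)) ^ 2) ^ (p / 4) / 4 := by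
        rw [← Real.rpow_natCast_mul (by positivity)]
        ring_nf
    _ ≤ ((M - m) ^ 4 * (M + m) ^ 2 / (4 * (M * m) ^ 3)) ^ (p / 4) / 4 := by gcongr
    _ = _ := (rpow_mul_rpow_div_eq hd (by positivity) hm₀ hM₀ p).symm

theorem norm_rpow_mul_rpow_neg_le_of_four_le {a b : 𝓐} {m M : ℝ} (hm₀ : 0 < m) (hmM : m ≤ M)
    (hm : m • 1 ≤ b) (hM : b ≤ M • 1) (ha : 0 ≤ a) (hab : a ≤ ((M - m) / (M + m)) ^ 2 • b)
    {p : ℝ} (hp : 4 ≤ p) :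
    ‖a ^ (p / 2) * b ^ (-(p / 2))‖ ≤ (M - m) ^ p * (M ^ 2 + m ^ 2) ^ (p / 2) /
      (2 ^ (2 + p / 2) * M ^ (3 * p / 4) * m ^ (3 * p / 4) * (M + m) ^ (p / 2)) := by
  have hM₀ : 0 < M := hm₀.trans_le hmM
  have hd : 0 ≤ M - m := sub_nonneg.2 hmM
  have hb : IsStrictlyPositive b := isStrictlyPositive_of_smul_one_le hm₀ hm
  have hsq : a ^ 2 ≤ (((M + m) * ((M - m) / (M + m)) ^ 2) ^ 2 / (4 * (M * m))) • b ^ 2 :=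
    sq_le_smul_sq hm₀ hM₀ hm hM ha (sq_nonneg _) hab
  have hm_sq : m ^ 2 • 1 ≤ b ^ 2 := by
    simpa [smul_pow] using sq_le_sq_of_commute (smul_nonneg hm₀.le zero_le_one) hm
      ((Commute.one_left b).smul_left m)
  have hM_sq : b ^ 2 ≤ M ^ 2 • 1 := by
    simpa [smul_pow] using sq_le_sq_of_commute hb.nonneg hM ((Commute.one_right b).smul_right M)
  have ha_rpow : a ^ (p / 2) = (a ^ 2) ^ (p / 4) := by
    rw [← CFC.rpow_natCast a 2,
      CFC.rpow_rpow_of_exponent_nonneg _ _ _ (by norm_num) (by positivity)]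
    ring_nf
  have hb_rpow : b ^ (-(p / 2)) = (b ^ 2) ^ (-(p / 4)) := by
    rw [← CFC.rpow_natCast b 2, CFC.rpow_rpow _ _ _ (by norm_num)]
    ring_nf
  calc ‖a ^ (p / 2) * b ^ (-(p / 2))‖
      ≤ (((M + m) * ((M - m) / (M + m)) ^ 2) ^ 2 / (4 * (M * m)) * (M ^ 2 + m ^ 2) ^ 2 /
          (M ^ 2 * m ^ 2)) ^ (p / 4) / 4 := by
        rw [ha_rpow, hb_rpow]
        exact norm_rpow_mul_rpow_neg_le (by positivity) (by positivity) hm_sq hM_sq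
          (ha.isSelfAdjoint.sq_nonneg) (by positivity) hsq (by linarith)
    _ = ((M - m) ^ 4 * ((M ^ 2 + m ^ 2) / (M + m)) ^ 2 / (4 * (M * m) ^ 3)) ^ (p / 4) / 4 := by
        congr 2
        field_simp
    _ = _ := by
        rw [← rpow_mul_rpow_div_eq hd (by positivity) hm₀ hM₀, Real.div_rpow (by positivity)
          (by positivity)]
        field_simp

end CStarAlgebra

section Operators

open ContinuousLinearMap

variable {H K : Type*} [NormedAddCommGroup H] [InnerProductSpace ℂ H]
  [NormedAddCommGroup K] [InnerProductSpace ℂ K]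

/-- The column operator `[U; V] : H → H ⊕ H`, `x ↦ (U x, V x)`. Positivity of an operator matrix
is transported through it in both directions. -/
def column (U V : H →L[ℂ] H) : H →L[ℂ] WithLp 2 (H × H) :=
  (WithLp.prodContinuousLinearEquiv 2 ℂ H H).symm.toContinuousLinearMap ∘L U.prod V

theorem column_apply (U V : H →L[ℂ] H) (x : H) : column U V x = WithLp.toLp 2 (U x, V x) := rfl

variable [CompleteSpace H] [CompleteSpace K]

theorem adjoint_column_apply (U V : H →L[ℂ] H) (z : WithLp 2 (H × H)) :
    adjoint (column U V) z = star U z.fst + star V z.snd := by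
  refine ext_inner_right ℂ fun x => ?_
  simp [adjoint_inner_left, column_apply, inner_add_left, star_eq_adjoint]

theorem opMatrix_conj_eq (A U V : H →L[ℂ] H) :
    opMatrix (star U * A * U) (star U * A * V) (star V * A * U) (star V * A * V) =
      column (star U) (star V) ∘L A ∘L adjoint (column (star U) (star V)) := by
  ext z
  simp [opMatrix, column_apply, adjoint_column_apply]

theorem opMatrix_conj_nonneg {A : H →L[ℂ] H} (hA : 0 ≤ A) (U V : H →L[ℂ] H) :
    0 ≤ opMatrix (star U * A * U) (star U * A * V) (star V * A * U) (star V * A * V) := by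
  rw [nonneg_iff_isPositive, opMatrix_conj_eq]
  exact ((nonneg_iff_isPositive A).1 hA).conj_adjoint _

theorem adjoint_column_comp_opMatrix (A B C D U V : H →L[ℂ] H) :
    adjoint (column U V) ∘L opMatrix A B C D ∘L column U V =
      star U * A * U + star U * B * V + star V * C * U + star V * D * V := by
  ext x
  simp [opMatrix, column_apply, adjoint_column_apply, add_assoc]

theorem nonneg_of_opMatrix_nonneg {A B C D : H →L[ℂ] H} (h : 0 ≤ opMatrix A B C D)
    (U V : H →L[ℂ] H) :
    0 ≤ star U * A * U + star U * B * V + star V * C * U + star V * D * V := by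
  rw [← adjoint_column_comp_opMatrix, nonneg_iff_isPositive]
  exact ((nonneg_iff_isPositive _).1 h).adjoint_conj _

theorem opMatrix_mono_left {A A' B C D : H →L[ℂ] H} (h : 0 ≤ opMatrix A B C D) (hA : A ≤ A') :
    0 ≤ opMatrix A' B C D := by
  have hsub : 0 ≤ opMatrix (A' - A) 0 0 0 := by
    simpa using opMatrix_conj_nonneg (sub_nonneg.2 hA) 1 0
  have hadd : opMatrix A' B C D = opMatrix A B C D + opMatrix (A' - A) 0 0 0 := by
    ext z
    simp [opMatrix, ← WithLp.toLp_add, add_right_comm _ (B z.snd)]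
  rw [hadd]
  exact add_nonneg h hsub

theorem mul_inverse_mul_le_of_opMatrix_nonneg {A B D : H →L[ℂ] H}
    (h : 0 ≤ opMatrix A B (star B) D) (hD : IsStrictlyPositive D) :
    B * D⁻¹ʳ * star B ≤ A := by
  have hs : star D⁻¹ʳ = D⁻¹ʳ := hD.ringInverse.nonneg.star_eq
  have hinv : D⁻¹ʳ * D = 1 := Ring.inverse_mul_cancel D hD.isUnit
  rw [← sub_nonneg]
  convert nonneg_of_opMatrix_nonneg h 1 (-(D⁻¹ʳ * star B)) using 1
  simp only [star_one, star_neg, star_mul, star_star, hs, one_mul, mul_one, mul_neg, neg_mul,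
    neg_neg, mul_assoc]
  rw [← mul_assoc D⁻¹ʳ D, hinv, one_mul]
  abel

theorem opMatrix_wielandt_nonneg {A X Y : H →L[ℂ] H} {m M : ℝ} (hm₀ : 0 < m) (hM₀ : 0 < M)
    (hm : m • 1 ≤ A) (hM : A ≤ M • 1) (hXY : star X * Y = 0) :
    0 ≤ opMatrix (((M - m) / (M + m)) ^ 2 • (star X * A * X)) (star X * A * Y)
      (star (star X * A * Y)) (star Y * A * Y) := by
  have hA : IsStrictlyPositive A := isStrictlyPositive_of_smul_one_le hm₀ hm
  -- As `X* Y = 0`, replacing `X` by `X - c A⁻¹ X` does not change the off-diagonal entries, and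
  -- this `c` minimizes the bound on the upper left corner.
  set c := 2 * (M * m) / (M + m) with hc
  set G := (1 - c • A⁻¹ʳ) * X with hG
  have hAG : A * G = A * X - c • X := by
    rw [hG, ← mul_assoc, mul_sub, mul_one, mul_smul_comm, Ring.mul_inverse_cancel A hA.isUnit,
      sub_mul, smul_mul_assoc, one_mul]
  have hGAY : star G * A * Y = star X * A * Y := by
    have hGA : star G * A = star X * A - c • star X := by
      simpa [hA.nonneg.star_eq] using congrArg star hAG
    rw [hGA, sub_mul, smul_mul_assoc, hXY, smul_zero, sub_zero]
  have hYAG : star Y * A * G = star (star X * A * Y) := by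
    rw [← hGAY]
    simp only [star_mul, star_star, hA.nonneg.star_eq, mul_assoc]
  have hGAG : star G * A * G ≤ ((M - m) / (M + m)) ^ 2 • (star X * A * X) := by
    convert star_left_conjugate_le_conjugate (conj_one_sub_smul_inverse_le hm₀ hM₀ hm hM) X using 1
    · simp only [hG, hc, star_mul, mul_assoc]
    · rw [mul_smul_comm, smul_mul_assoc]
  have hcorner := opMatrix_conj_nonneg hA.nonneg G Y
  rw [hGAY, hYAG] at hcorner
  exact opMatrix_mono_left hcorner hGAG

section IsTwoPositive

variable {Φ : (H →L[ℂ] H) →ₗ[ℂ] (K →L[ℂ] K)}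

theorem IsTwoPositive.nonneg (hΦ : IsTwoPositive Φ) {A : H →L[ℂ] H} (hA : 0 ≤ A) : 0 ≤ Φ A := by
  have h : 0 ≤ opMatrix A 0 (star 0) 0 := by simpa using opMatrix_conj_nonneg hA 1 0
  simpa using nonneg_of_opMatrix_nonneg (hΦ A 0 0 h) 1 0

theorem IsTwoPositive.monotone (hΦ : IsTwoPositive Φ) : Monotone Φ :=
  (PositiveLinearMap.mk₀ Φ fun _ => hΦ.nonneg).monotone'

theorem IsTwoPositive.map_star (hΦ : IsTwoPositive Φ) (A : H →L[ℂ] H) :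
    Φ (star A) = star (Φ A) :=
  StarHomClass.map_star (PositiveLinearMap.mk₀ Φ fun _ => hΦ.nonneg) A

theorem IsTwoPositive.smul_one_le_map_conj (hΦ : IsTwoPositive Φ) (hΦ₁ : Φ 1 = 1) {A X : H →L[ℂ] H}
    (hX : star X * X = 1) {m : ℝ} (hm : m • 1 ≤ A) : m • 1 ≤ Φ (star X * A * X) := by
  have h := hΦ.monotone (star_left_conjugate_le_conjugate hm X)
  rwa [mul_smul_comm, mul_one, smul_mul_assoc, hX, LinearMap.map_smul_of_tower, hΦ₁] at h

theorem IsTwoPositive.map_conj_le_smul_one (hΦ : IsTwoPositive Φ) (hΦ₁ : Φ 1 = 1) {A X : H →L[ℂ] H}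
    (hX : star X * X = 1) {M : ℝ} (hM : A ≤ M • 1) : Φ (star X * A * X) ≤ M • 1 := by
  have h := hΦ.monotone (star_left_conjugate_le_conjugate hM X)
  rwa [mul_smul_comm, mul_one, smul_mul_assoc, hX, LinearMap.map_smul_of_tower, hΦ₁] at h

theorem IsTwoPositive.wielandtOp_eq (hΦ : IsTwoPositive Φ) {A : H →L[ℂ] H}
    (hA : IsSelfAdjoint A) (X Y : H →L[ℂ] H) :
    wielandtOp Φ A X Y =
      Φ (star X * A * Y) * (Φ (star Y * A * Y))⁻¹ʳ * star (Φ (star X * A * Y)) := by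
  rw [wielandtOp, ← hΦ.map_star, star_mul, star_mul, star_star, hA.star_eq, mul_assoc (star Y) A X]

theorem IsTwoPositive.wielandtOp_nonneg (hΦ : IsTwoPositive Φ) {A Y : H →L[ℂ] H}
    (hA : IsSelfAdjoint A) (hY : IsStrictlyPositive (Φ (star Y * A * Y))) (X : H →L[ℂ] H) :
    0 ≤ wielandtOp Φ A X Y := by
  rw [hΦ.wielandtOp_eq hA]
  exact star_right_conjugate_nonneg hY.ringInverse.nonneg _

theorem IsTwoPositive.wielandtOp_le (hΦ : IsTwoPositive Φ) {A X Y : H →L[ℂ] H} {m M : ℝ}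
    (hm₀ : 0 < m) (hM₀ : 0 < M) (hm : m • 1 ≤ A) (hM : A ≤ M • 1) (hXY : star X * Y = 0)
    (hY : IsStrictlyPositive (Φ (star Y * A * Y))) :
    wielandtOp Φ A X Y ≤ ((M - m) / (M + m)) ^ 2 • Φ (star X * A * X) := by
  have hA : IsStrictlyPositive A := isStrictlyPositive_of_smul_one_le hm₀ hm
  rw [hΦ.wielandtOp_eq hA.nonneg.isSelfAdjoint, ← LinearMap.map_smul_of_tower]
  refine mul_inverse_mul_le_of_opMatrix_nonneg ?_ hY
  rw [← hΦ.map_star]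
  exact hΦ _ _ _ (opMatrix_wielandt_nonneg hm₀ hM₀ hm hM hXY)

end IsTwoPositive

theorem star_mul_self_eq_one_of_isometry {X : H →L[ℂ] H} (hX : Isometry X) : star X * X = 1 :=
  (norm_map_iff_adjoint_comp_self X).1 ((AddMonoidHomClass.isometry_iff_norm X).1 hX)

theorem star_mul_eq_zero_of_range_isOrtho {X Y : H →L[ℂ] H} (h : X.range ⟂ Y.range) :
    star X * Y = 0 := by
  ext y
  refine ext_inner_left ℂ fun x => ?_
  simpa [star_eq_adjoint, adjoint_inner_right] using
    Submodule.isOrtho_iff_inner_eq.1 h (X x) (LinearMap.mem_range_self _ x) (Y y)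
      (LinearMap.mem_range_self _ y)

end Operators

end WielandtNorm

theorem corollary3p2 {H K : Type*}
    [NormedAddCommGroup H] [InnerProductSpace ℂ H] [CompleteSpace H]
    [NormedAddCommGroup K] [InnerProductSpace ℂ K] [CompleteSpace K]
    (m M : ℝ) (hm : 0 < m) (hmM : m ≤ M)
    (A : H →L[ℂ] H)
    (hmA : m • (1 : H →L[ℂ] H) ≤ A) (hAM : A ≤ M • (1 : H →L[ℂ] H))
    (X Y : H →L[ℂ] H) (hX : Isometry X) (hY : Isometry Y)
    (hXY : X.range ⟂ Y.range)
    (Φ : (H →L[ℂ] H) →ₗ[ℂ] (K →L[ℂ] K))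
    (hΦ : WielandtNorm.IsTwoPositive Φ) (hΦ1 : Φ 1 = 1) :
    (0 ≤ Φ (star Y * A * Y) ∧ IsUnit (Φ (star Y * A * Y))) ∧
    (0 ≤ Φ (star X * A * X) ∧ IsUnit (Φ (star X * A * X))) ∧
    0 ≤ WielandtNorm.wielandtOp Φ A X Y ∧
    (∀ p : ℝ, 2 ≤ p →
      ‖(WielandtNorm.wielandtOp Φ A X Y) ^ (p / 2) * (Φ (star X * A * X)) ^ (-(p / 2))‖ ≤
        (M - m) ^ p * (M + m) ^ (p / 2) /
          ((2 : ℝ) ^ (2 + p / 2) * M ^ (3 * p / 4) * m ^ (3 * p / 4))) ∧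
    (∀ p : ℝ, 4 ≤ p →
      ‖(WielandtNorm.wielandtOp Φ A X Y) ^ (p / 2) * (Φ (star X * A * X)) ^ (-(p / 2))‖ ≤
        (M - m) ^ p * (M ^ 2 + m ^ 2) ^ (p / 2) /
          ((2 : ℝ) ^ (2 + p / 2) * M ^ (3 * p / 4) * m ^ (3 * p / 4) * (M + m) ^ (p / 2))) := by
  have hM : 0 < M := hm.trans_le hmM
  have hA : 0 ≤ A := (smul_nonneg hm.le zero_le_one).trans hmA
  have hX₁ := WielandtNorm.star_mul_self_eq_one_of_isometry hX
  have hY₁ := WielandtNorm.star_mul_self_eq_one_of_isometry hY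
  have hXY₀ := WielandtNorm.star_mul_eq_zero_of_range_isOrtho hXY
  have hmX := hΦ.smul_one_le_map_conj hΦ1 hX₁ hmA
  have hXM := hΦ.map_conj_le_smul_one hΦ1 hX₁ hAM
  have hX_pos := WielandtNorm.isStrictlyPositive_of_smul_one_le hm hmX
  have hmY := hΦ.smul_one_le_map_conj hΦ1 hY₁ hmA
  have hY_pos := WielandtNorm.isStrictlyPositive_of_smul_one_le hm hmY
  have hZ₀ := hΦ.wielandtOp_nonneg hA.isSelfAdjoint hY_pos X
  have hZ := hΦ.wielandtOp_le hm hM hmA hAM hXY₀ hY_pos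
  exact ⟨⟨hY_pos.nonneg, hY_pos.isUnit⟩, ⟨hX_pos.nonneg, hX_pos.isUnit⟩, hZ₀,
    fun p hp => WielandtNorm.norm_rpow_mul_rpow_neg_le_of_two_le hm hmM hmX hXM hZ₀ hZ hp,
    fun p hp => WielandtNorm.norm_rpow_mul_rpow_neg_le_of_four_le hm hmM hmX hXM hZ₀ hZ hp⟩
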